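/- A finite digraph is a pair $G=(V,E)$, where $V$ is a nonempty finite set and $E\subseteq V^2$ is an arbitrary binary relation on $V$ (loops are allowed). Let $\mathcal{D}$ denote the set of isomorphism types of finite digraphs, and write $G\sqsubseteq G'$ if $G$ is isomorphic to an induced substructure of $G'$ on some nonempty subset of its vertices; $\sqsubseteq$ is a partial order on $\mathcal{D}$. Theorem. The automorphism group of the poset $(\mathcal{D};\sqsubseteq)$ is finite. -/

import Mathlib

/-- A finite directed graph `G = (V, E)`: a nonempty finite vertex set `V` and an arbitrary binary
relation `E ⊆ V²` on it (loops and edges in both directions are allowed). -/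
structure FinDigraph where
  /-- The vertices of the digraph. -/
  V : Type
  [finite_V : Finite V]
  [nonempty_V : Nonempty V]
  /-- The edges of the digraph. -/
  graph : Digraph V

attribute [instance] FinDigraph.finite_V FinDigraph.nonempty_V

namespace FinDigraph

/-- Isomorphism of digraphs: a bijection of the vertices that preserves and reflects edges. -/
def Iso (G H : FinDigraph) : Prop :=
  Nonempty (G.graph.Adj ≃r H.graph.Adj)

/-- The substructure of `G` induced on a nonempty set `s` of its vertices. -/
def induce (G : FinDigraph) (s : Set G.V) (hs : s.Nonempty) : FinDigraph where
  V := s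
  nonempty_V := hs.to_subtype
  graph := ⟨fun a b => G.graph.Adj a b⟩

/-- `G` is a substructure of `H`: it is isomorphic to an induced substructure of `H`
on some set of vertices. -/
def IsSubstructure (G H : FinDigraph) : Prop :=
  ∃ (s : Set H.V) (hs : s.Nonempty), G.Iso (H.induce s hs)

theorem isSubstructure_iff (G H : FinDigraph) :
    G.IsSubstructure H ↔ Nonempty (G.graph.Adj ↪r H.graph.Adj) := by
  constructor
  · rintro ⟨s, hs, ⟨e⟩⟩
    exact ⟨⟨⟨fun v => (e v : s).1, fun a b h => e.injective (Subtype.ext h)⟩,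
      fun {a b} => e.map_rel_iff (a := a) (b := b)⟩⟩
  · rintro ⟨f⟩
    exact ⟨Set.range f, Set.range_nonempty f,
      ⟨⟨Equiv.ofInjective f f.injective, fun {a b} => f.map_rel_iff (a := a) (b := b)⟩⟩⟩

theorem IsSubstructure.refl (G : FinDigraph) : G.IsSubstructure G :=
  (isSubstructure_iff G G).2 ⟨RelEmbedding.refl _⟩

theorem IsSubstructure.trans {G H K : FinDigraph} (h₁ : G.IsSubstructure H)
    (h₂ : H.IsSubstructure K) : G.IsSubstructure K := by
  obtain ⟨f⟩ := (isSubstructure_iff G H).1 h₁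
  obtain ⟨g⟩ := (isSubstructure_iff H K).1 h₂
  exact (isSubstructure_iff G K).2 ⟨f.trans g⟩

theorem Iso.isSubstructure {G H : FinDigraph} (h : G.Iso H) : G.IsSubstructure H :=
  (isSubstructure_iff G H).2 (h.map fun e => e.toRelEmbedding)

theorem IsSubstructure.antisymm {G H : FinDigraph} (h₁ : G.IsSubstructure H)
    (h₂ : H.IsSubstructure G) : G.Iso H := by
  obtain ⟨f⟩ := (isSubstructure_iff G H).1 h₁
  obtain ⟨g⟩ := (isSubstructure_iff H G).1 h₂
  have hcard : Nat.card G.V = Nat.card H.V :=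
    le_antisymm (Nat.card_le_card_of_injective f f.injective)
      (Nat.card_le_card_of_injective g g.injective)
  have hbij : Function.Bijective f :=
    (Nat.bijective_iff_injective_and_card f).2 ⟨f.injective, hcard⟩
  exact ⟨RelIso.ofSurjective f hbij.surjective⟩

/-- Isomorphism as an equivalence relation. -/
instance isoSetoid : Setoid FinDigraph where
  r := Iso
  iseqv :=
    { refl := fun _ => ⟨RelIso.refl _⟩
      symm := fun h => h.map RelIso.symm
      trans := fun ⟨e⟩ ⟨f⟩ => ⟨e.trans f⟩ }

end FinDigraph

/-- The set `𝒟` of isomorphism types of finite digraphs. -/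
def DigraphType : Type 1 := Quotient FinDigraph.isoSetoid

namespace DigraphType

/-- The isomorphism type of a finite digraph. -/
def mk (G : FinDigraph) : DigraphType := Quotient.mk FinDigraph.isoSetoid G

/-- The partial order `⊑` on `𝒟`, written `≤` here: being a substructure. -/
instance : PartialOrder DigraphType where
  le := Quotient.lift₂ FinDigraph.IsSubstructure fun _ _ _ _ h₁ h₂ => propext
    ⟨fun h => ((Setoid.symm h₁ : FinDigraph.Iso _ _).isSubstructure.trans h).trans
        (FinDigraph.Iso.isSubstructure h₂),
      fun h => ((FinDigraph.Iso.isSubstructure h₁).trans h).trans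
        (Setoid.symm h₂ : FinDigraph.Iso _ _).isSubstructure⟩
  le_refl := by
    rintro ⟨G⟩
    exact FinDigraph.IsSubstructure.refl G
  le_trans := by
    rintro ⟨G⟩ ⟨H⟩ ⟨K⟩ h₁ h₂
    exact FinDigraph.IsSubstructure.trans h₁ h₂
  le_antisymm := by
    rintro ⟨G⟩ ⟨H⟩ h₁ h₂
    exact Quotient.sound (FinDigraph.IsSubstructure.antisymm h₁ h₂)

theorem mk_le_mk (G H : FinDigraph) : mk G ≤ mk H ↔ G.IsSubstructure H := Iff.rfl

theorem mk_eq_mk (G H : FinDigraph) : mk G = mk H ↔ G.Iso H :=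
  ⟨fun h => Quotient.exact h, fun h => Quotient.sound h⟩

end DigraphType

/-! Every automorphism preserves the number of vertices, which is the height in the poset. There are
finitely many types with at most four vertices, so it suffices that an automorphism `φ` fixing all
of these (`FixesSmall`) is the identity: then restriction to small types is injective on
automorphisms.

Such a `φ` fixes every reflexive chain (`FixesSmall.chain`), since the axioms of a linear order
involve at most three vertices. A rigid core of at most two loopless vertices attached to a chain is
a word over a finite alphabet, and a word of length at least three is determined by its subwords of
codimension one; by induction these digraphs are fixed (`FixesSmall.attach_rigid`). A larger core
can be assembled from its pairs when the chain embeds in only one way and names the vertices of the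
core (`FixesSmall.attach_of_pairs`).

Any loopless digraph `ρ` is now fixed: attach a chain naming its vertices; the result is fixed, and
inside it a loopless digraph of the same size as `ρ` must be `ρ`. Complementing loops is an
automorphism of the poset, so digraphs with all loops are fixed as well.

With mixed loops, complementation allows the assumption that looped vertices are not in the
majority. Again a chain is attached, but the image of `ρ` might use a chain vertex in place of a
looped vertex of `ρ`. The chain is therefore attached so that each of its vertices sees the loopless
part in a pattern of edge counts that no looped vertex of `ρ` shows (`exists_unrealized_count`,
`FixesSmall.fixed_of_card_le`). -/

namespace DigraphType

/-! ### Size, and automorphisms fixing the small types -/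

/-- The isomorphism type of a binary relation on a nonempty finite type. -/
def ofRel {V : Type} [Finite V] [Nonempty V] (r : V → V → Prop) : DigraphType :=
  mk { V := V, graph := ⟨r⟩ }

theorem exists_ofRel (x : DigraphType) :
    ∃ (V : Type) (_ : Finite V) (_ : Nonempty V) (r : V → V → Prop), x = ofRel r := by
  obtain ⟨G⟩ := x
  exact ⟨G.V, G.finite_V, G.nonempty_V, G.graph.Adj, rfl⟩

section
variable {V W : Type} [Finite V] [Nonempty V] [Finite W] [Nonempty W]
  {r : V → V → Prop} {s : W → W → Prop}

theorem ofRel_le : ofRel r ≤ ofRel s ↔ Nonempty (r ↪r s) :=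
  (mk_le_mk _ _).trans (FinDigraph.isSubstructure_iff _ _)

theorem ofRel_eq : ofRel r = ofRel s ↔ Nonempty (r ≃r s) := mk_eq_mk _ _

/-- The number of vertices. -/
noncomputable def size : DigraphType → ℕ :=
  Quotient.lift (fun G => Nat.card G.V) fun _ _ ⟨e⟩ => Nat.card_congr e.toEquiv

theorem size_ofRel : size (ofRel r) = Nat.card V := rfl

theorem size_mono {x y : DigraphType} (h : x ≤ y) : size x ≤ size y := by
  obtain ⟨V, _, _, r, rfl⟩ := exists_ofRel x
  obtain ⟨W, _, _, s, rfl⟩ := exists_ofRel y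
  obtain ⟨f⟩ := ofRel_le.1 h
  exact Nat.card_le_card_of_injective f f.injective

theorem eq_of_le_of_size_le {x y : DigraphType} (h : x ≤ y) (hs : size y ≤ size x) : x = y := by
  obtain ⟨V, _, _, r, rfl⟩ := exists_ofRel x
  obtain ⟨W, _, _, s, rfl⟩ := exists_ofRel y
  obtain ⟨f⟩ := ofRel_le.1 h
  have hbij : Function.Bijective f :=
    (Nat.bijective_iff_injective_and_card f).2 ⟨f.injective, le_antisymm (size_mono h) hs⟩
  exact ofRel_eq.2 ⟨RelIso.ofSurjective f hbij.surjective⟩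

theorem size_lt {x y : DigraphType} (h : x < y) : size x < size y :=
  lt_of_not_ge fun hs => h.ne (eq_of_le_of_size_le h.le hs)

theorem size_pos (x : DigraphType) : 0 < size x := by
  obtain ⟨V, _, _, r, rfl⟩ := exists_ofRel x
  exact Nat.card_pos

/-- The embedding of an induced subrelation. -/
def subEmb (r : V → V → Prop) (S : Set V) : (fun a b : S => r a b) ↪r r :=
  ⟨⟨Subtype.val, Subtype.val_injective⟩, Iff.rfl⟩

theorem exists_le_size {x : DigraphType} {n : ℕ} (h0 : 0 < n) (hn : n ≤ size x) :
    ∃ y ≤ x, size y = n := by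
  obtain ⟨V, _, _, r, rfl⟩ := exists_ofRel x
  have : Fintype V := Fintype.ofFinite V
  obtain ⟨S, -, hS⟩ := Finset.exists_subset_card_eq (s := (Finset.univ : Finset V)) (n := n)
    (by rwa [Finset.card_univ, ← Nat.card_eq_fintype_card])
  have hne : Nonempty (S : Set V) := (Finset.card_pos.1 (hS ▸ h0)).to_subtype
  refine ⟨ofRel fun a b : (S : Set V) => r a b, ofRel_le.2 ⟨subEmb r _⟩, ?_⟩
  rw [size_ofRel]
  simpa using hS

/-- Deleting a vertex gives a strictly smaller type, and `φ` preserves strict inequality, so the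
size of the image grows at least as fast. -/
theorem size_le_size_map (φ : DigraphType ≃o DigraphType) (n : ℕ) :
    ∀ x, size x = n + 1 → n + 1 ≤ size (φ x) := by
  induction n with
  | zero => exact fun x _ => size_pos _
  | succ n ih =>
    intro x hx
    obtain ⟨y, hy, hyn⟩ := exists_le_size (x := x) (n := n + 1) (by omega) (by omega)
    have hlt : y < x := lt_of_le_of_ne hy (by rintro rfl; omega)
    have := size_lt (φ.lt_iff_lt.2 hlt)
    have := ih y hyn
    omega

theorem size_map (φ : DigraphType ≃o DigraphType) (x : DigraphType) : size (φ x) = size x := by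
  have key : ∀ (ψ : DigraphType ≃o DigraphType) y, size y ≤ size (ψ y) := fun ψ y => by
    have := size_pos y
    have := size_le_size_map ψ (size y - 1) y (by omega)
    omega
  refine le_antisymm ?_ (key φ x)
  simpa using key φ.symm (φ x)

theorem finite_size_le (N : ℕ) : Finite {x : DigraphType // size x ≤ N} := by
  let f : (Σ n : Fin N, Fin (n + 1) → Fin (n + 1) → Prop) → {x : DigraphType // size x ≤ N} :=
    fun p => ⟨ofRel p.2, by rw [size_ofRel, Nat.card_fin]; exact p.1.2⟩
  refine Finite.of_surjective f ?_
  rintro ⟨x, hx⟩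
  obtain ⟨V, _, _, r, rfl⟩ := exists_ofRel x
  rw [size_ofRel] at hx
  have h0 : 0 < Nat.card V := Nat.card_pos
  have e : V ≃ Fin (Nat.card V - 1 + 1) :=
    (Finite.equivFin V).trans (finCongr (by omega))
  refine ⟨⟨⟨Nat.card V - 1, by omega⟩, fun a b => r (e.symm a) (e.symm b)⟩, ?_⟩
  exact Subtype.ext (ofRel_eq.2 ⟨⟨e.symm, Iff.rfl⟩⟩)

/-- An automorphism that fixes all isomorphism types with at most four vertices. -/
def FixesSmall (φ : DigraphType ≃o DigraphType) : Prop :=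
  ∀ x, size x ≤ 4 → φ x = x

theorem FixesSmall.symm {φ : DigraphType ≃o DigraphType} (hφ : FixesSmall φ) :
    FixesSmall φ.symm := fun x hx => by rw [OrderIso.symm_apply_eq, hφ x hx]

theorem le_iff_of_fixed {φ : DigraphType ≃o DigraphType} {q x y : DigraphType} (h : φ x = y)
    (hq : φ q = q) : q ≤ x ↔ q ≤ y := by
  rw [← h]
  nth_rewrite 2 [← hq]
  exact φ.le_iff_le.symm

/-- The substructure on the range of `p` is small, hence fixed, hence also lies below the preimage.
Universal properties in at most four variables thus pass from `r` to `s`. -/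
theorem FixesSmall.exists_local {φ : DigraphType ≃o DigraphType} (hφ : FixesSmall φ)
    (h : φ (ofRel r) = ofRel s) {ι : Type} [Finite ι] [Nonempty ι] (hι : Nat.card ι ≤ 4)
    (p : ι → W) :
    ∃ q : ι → V, (∀ i j, q i = q j ↔ p i = p j) ∧ ∀ i j, r (q i) (q j) ↔ s (p i) (p j) := by
  have hle : ofRel (fun a b : Set.range p => s a b) ≤ ofRel r := by
    rw [le_iff_of_fixed h (hφ _ _)]
    · exact ofRel_le.2 ⟨subEmb s _⟩
    · rw [size_ofRel]
      exact (Nat.card_le_card_of_surjective _ Set.rangeFactorization_surjective).trans hι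
  obtain ⟨f⟩ := ofRel_le.1 hle
  refine ⟨fun i => f ⟨p i, i, rfl⟩, fun i j => ?_, fun i j => f.map_rel_iff⟩
  exact f.injective.eq_iff.trans Subtype.ext_iff

theorem card_eq_of_map {φ : DigraphType ≃o DigraphType} (h : φ (ofRel r) = ofRel s) :
    Nat.card W = Nat.card V := by
  rw [← size_ofRel (r := s), ← h, size_map, size_ofRel]

end

/-! ### Reflexive chains -/

/-- The transitive tournament with all loops is fixed. -/
theorem FixesSmall.chain {φ : DigraphType ≃o DigraphType} (hφ : FixesSmall φ) (m : ℕ) [NeZero m] :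
    φ (ofRel fun i j : Fin m => i ≤ j) = ofRel fun i j : Fin m => i ≤ j := by
  obtain ⟨W, _, _, s, h⟩ := exists_ofRel (φ (ofRel fun i j : Fin m => i ≤ j))
  rw [h]
  have hcard := card_eq_of_map h
  rw [Nat.card_fin] at hcard
  -- Each axiom of a linear order involves at most three vertices, so it is inherited by `s`; a
  -- finite linear order is determined by its size.
  have loc := fun a b c : W => hφ.exists_local h (ι := Fin 3) (by simp) ![a, b, c]
  have hrefl : ∀ a, s a a := fun a => by
    obtain ⟨q, -, hq⟩ := loc a a a
    exact (hq 0 0).1 le_rfl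
  have htrans : ∀ a b c, s a b → s b c → s a c := fun a b c hab hbc => by
    obtain ⟨q, -, hq⟩ := loc a b c
    exact (hq 0 2).1 (((hq 0 1).2 hab).trans ((hq 1 2).2 hbc))
  have hanti : ∀ a b, s a b → s b a → a = b := fun a b hab hba => by
    obtain ⟨q, hq', hq⟩ := loc a b b
    exact (hq' 0 1).1 (le_antisymm ((hq 0 1).2 hab) ((hq 1 0).2 hba))
  have htot : ∀ a b, s a b ∨ s b a := fun a b => by
    obtain ⟨q, -, hq⟩ := loc a b b
    exact (le_total (q 0) (q 1)).imp (hq 0 1).1 (hq 1 0).1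
  classical
  let _ : LinearOrder W :=
    { le := s
      le_refl := hrefl
      le_trans := htrans
      le_antisymm := hanti
      le_total := htot
      toDecidableLE := Classical.decRel _ }
  have : Fintype W := Fintype.ofFinite W
  have e := Fintype.orderIsoFinOfCardEq W (k := m) (by rw [← Nat.card_eq_fintype_card, hcard])
  exact (ofRel_eq.2 ⟨e⟩).symm

theorem chain_embedding_eq {m : ℕ} {f : Fin m → Fin m} (hf : ∀ i j, f i ≤ f j ↔ i ≤ j) (i : Fin m) :
    f i = i := by
  have hmono : StrictMono f := fun i j hij => by
    rw [← not_le] at hij ⊢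
    rwa [hf]
  exact congrFun ((hmono.range_inj (strictMono_id (α := Fin m))).1 (by
    rw [(Finite.injective_iff_surjective.1 hmono.injective).range_eq, Set.range_id])) i

end DigraphType

/-! ### Words determined by their subwords -/

open List in
/-- A word of length at least three is determined by its subwords of codimension one. -/
theorem List.eq_of_sublist_iff {α : Type*} : ∀ (l l' : List α), l.length = l'.length →
    3 ≤ l.length → (∀ p : List α, p.length + 1 = l.length → (p <+ l ↔ p <+ l')) → l = l' := by
  intro l
  induction l with
  | nil => simp
  | cons a u ih =>
    intro l' hlen h3 h
    obtain _ | ⟨b, v⟩ := l'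
    · simp at hlen
    simp only [length_cons] at hlen h3 h
    -- A common head can be cancelled until length three, which is checked directly. Different heads
    -- are contradictory: a subword starting with `a` must avoid the head `b`, so it is the whole
    -- tail of the other word. Deleting either of two letters then forces all the leading letters to
    -- agree.
    by_cases hab : a = b
    · subst hab
      by_cases hu : u.length = 2
      · obtain ⟨x, y, rfl⟩ := length_eq_two.1 hu
        obtain ⟨x', y', rfl⟩ := length_eq_two.1 (show v.length = 2 by simpa using hlen.symm)
        have h1 := h [x, y] rfl
        have h2 := h [x', y'] rfl
        have h3 := h [a, y] rfl
        have h4 := h [a, x] rfl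
        have h5 := h [a, y'] rfl
        have h6 := h [a, x'] rfl
        clear h ih
        simp [sublist_cons_iff] at *
        grind
      · rw [ih v (by omega) (by omega)]
        intro p hp
        simpa using h (a :: p) (by simp; omega)
    · obtain _ | ⟨x, _ | ⟨y, u⟩⟩ := u
      · simp at h3
      · simp at h3
      obtain _ | ⟨x', _ | ⟨y', v⟩⟩ := v
      · simp at hlen
      · simp at hlen
      simp only [length_cons] at hlen h
      have hlen' : u.length = v.length := by omega
      have left : ∀ p, p.length = u.length + 1 → p <+ x :: y :: u → a :: p = x' :: y' :: v :=
        fun p hp hpu => by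
          have h1 := (h (a :: p) (by simp; omega)).1 (hpu.cons_cons a)
          rw [sublist_cons_iff] at h1
          obtain h1 | ⟨r, hr, -⟩ := h1
          · exact h1.eq_of_length (by simp; omega)
          · simp [hab] at hr
      have right : ∀ p, p.length = u.length + 1 → p <+ x' :: y' :: v → b :: p = x :: y :: u :=
        fun p hp hpu => by
          have h1 := (h (b :: p) (by simp; omega)).2 (hpu.cons_cons b)
          rw [sublist_cons_iff] at h1
          obtain h1 | ⟨r, hr, -⟩ := h1
          · exact h1.eq_of_length (by simp; omega)
          · simp [Ne.symm hab] at hr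
      have e1 := left (y :: u) (by simp) (by simp)
      have e2 := left (x :: u) (by simp) (by simp)
      have e3 := right (y' :: v) (by simp; omega) (by simp)
      have e4 := right (x' :: v) (by simp; omega) (by simp)
      grind

theorem Fin.word_eq_of_subword_iff {α : Type*} {m : ℕ} (hm : 2 ≤ m) (w w' : Fin (m + 1) → α)
    (h : ∀ u : Fin m → α, (∃ g : Fin m ↪o Fin (m + 1), ∀ i, u i = w (g i)) ↔
      ∃ g : Fin m ↪o Fin (m + 1), ∀ i, u i = w' (g i)) : w = w' := by
  have key : ∀ (u : Fin m → α) (w : Fin (m + 1) → α),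
      (∃ g : Fin m ↪o Fin (m + 1), ∀ i, u i = w (g i)) ↔
        (List.ofFn u).Sublist (List.ofFn w) := fun u w => by
    rw [List.sublist_iff_exists_fin_orderEmbedding_get_eq]
    let e1 : Fin (List.ofFn u).length ≃o Fin m := Fin.castOrderIso List.length_ofFn
    let e2 : Fin (List.ofFn w).length ≃o Fin (m + 1) := Fin.castOrderIso List.length_ofFn
    constructor
    · rintro ⟨g, hg⟩
      refine ⟨(e1.toOrderEmbedding.trans g).trans e2.symm.toOrderEmbedding, fun i => ?_⟩
      simp only [List.get_ofFn]
      exact hg _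
    · rintro ⟨g, hg⟩
      refine ⟨(e1.symm.toOrderEmbedding.trans g).trans e2.toOrderEmbedding, fun i => ?_⟩
      have := hg (e1.symm i)
      simp only [List.get_ofFn] at this
      exact this
  refine List.ofFn_injective (List.eq_of_sublist_iff _ _ (by simp) (by simpa using hm) ?_)
  intro p hp
  have hp' : p.length = m := by simpa using hp
  subst hp'
  have := h p.get
  rwa [key, key, List.ofFn_get] at this

/-! ### Cores attached to a chain -/

namespace DigraphType

/-- The relation on `Fin m ⊕ F` that consists of a transitive tournament with all loops, the
relation `ρ` on `F`, and edges between the parts in both directions as prescribed by `w`. -/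
def attach {m : ℕ} {F : Type} (w : Fin m → F → Prop × Prop) (ρ : F → F → Prop) :
    Fin m ⊕ F → Fin m ⊕ F → Prop
  | .inl i, .inl j => i ≤ j
  | .inl i, .inr f => (w i f).1
  | .inr f, .inl i => (w i f).2
  | .inr f, .inr g => ρ f g

section
variable {m k : ℕ} {E F : Type} (w : Fin m → F → Prop × Prop) (ρ : F → F → Prop)

@[simp] theorem attach_inl_inl (i j : Fin m) : attach w ρ (.inl i) (.inl j) ↔ i ≤ j := Iff.rfl
@[simp] theorem attach_inl_inr (i : Fin m) (f : F) :
    attach w ρ (.inl i) (.inr f) ↔ (w i f).1 := Iff.rfl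
@[simp] theorem attach_inr_inl (i : Fin m) (f : F) :
    attach w ρ (.inr f) (.inl i) ↔ (w i f).2 := Iff.rfl
@[simp] theorem attach_inr_inr (f g : F) : attach w ρ (.inr f) (.inr g) ↔ ρ f g := Iff.rfl

def attachEmb (g : Fin k ↪o Fin m) (p : E ↪ F) :
    attach (fun i e => w (g i) (p e)) (fun a b => ρ (p a) (p b)) ↪r attach w ρ :=
  ⟨⟨Sum.map g p, Sum.map_injective.2 ⟨g.injective, p.injective⟩⟩, by
    rintro (i | e) (j | f) <;> simp⟩

def inlEmb : (fun i j : Fin m => i ≤ j) ↪r attach w ρ := ⟨⟨Sum.inl, Sum.inl_injective⟩, Iff.rfl⟩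

def inrEmb : ρ ↪r attach w ρ := ⟨⟨Sum.inr, Sum.inr_injective⟩, Iff.rfl⟩

@[simp] theorem inlEmb_apply (i : Fin m) : inlEmb w ρ i = .inl i := rfl

end

theorem ofRel_eq_attach {W F : Type} [Finite W] [Nonempty W] [Finite F] {m : ℕ}
    [Nonempty (Fin m ⊕ F)] {s : W → W → Prop} {ρ : F → F → Prop}
    (e : (fun i j : Fin m => i ≤ j) ↪r s) (g : ρ ↪r s) (hd : ∀ i f, e i ≠ g f)
    (hc : Nat.card W ≤ m + Nat.card F) :
    ofRel (attach (fun i f => (s (e i) (g f), s (g f) (e i))) ρ) = ofRel s := by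
  refine eq_of_le_of_size_le (ofRel_le.2 ⟨⟨⟨Sum.elim e g, ?_⟩, ?_⟩⟩) ?_
  · exact e.injective.sumElim g.injective hd
  · rintro (i | f) (j | f') <;> simp
    · exact e.map_rel_iff
    · exact g.map_rel_iff
  · rwa [size_ofRel, size_ofRel, Nat.card_sum, Nat.card_fin]

/-- Chain vertices have loops and core vertices do not, so an embedding respects the two parts. -/
theorem exists_of_attach_emb {m k : ℕ} {E F : Type} {u : Fin k → E → Prop × Prop}
    {τ : E → E → Prop} {w : Fin m → F → Prop × Prop} {ρ : F → F → Prop}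
    (hτ : ∀ f, ¬ τ f f) (hρ : ∀ f, ¬ ρ f f) (γ : attach u τ ↪r attach w ρ) :
    ∃ (g : Fin k ↪o Fin m) (p : τ ↪r ρ), (∀ i, γ (.inl i) = .inl (g i)) ∧
      (∀ f, γ (.inr f) = .inr (p f)) ∧ ∀ i f, u i f = w (g i) (p f) := by
  have h1 : ∀ i, ∃ j, γ (.inl i) = .inl j := fun i => by
    have := (γ.map_rel_iff (a := .inl i) (b := .inl i)).2 le_rfl
    rcases hx : γ (.inl i) with j | f
    · exact ⟨j, rfl⟩
    · rw [hx] at this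
      exact absurd this (hρ f)
  have h2 : ∀ e, ∃ f, γ (.inr e) = .inr f := fun e => by
    have := mt (γ.map_rel_iff (a := .inr e) (b := .inr e)).1 (hτ e)
    rcases hx : γ (.inr e) with j | f
    · rw [hx] at this
      exact absurd le_rfl this
    · exact ⟨f, rfl⟩
  choose g hg using h1
  choose p hp using h2
  refine ⟨⟨⟨g, fun i j hij => ?_⟩, fun {i j} => ?_⟩, ⟨⟨p, fun i j hij => ?_⟩, fun {i j} => ?_⟩,
    hg, hp, fun i f => Prod.ext (propext ?_) (propext ?_)⟩
  · exact Sum.inl_injective (γ.injective (by rw [hg, hg, hij]))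
  · have := γ.map_rel_iff (a := .inl i) (b := .inl j)
    rwa [hg, hg] at this
  · exact Sum.inr_injective (γ.injective (by rw [hp, hp, hij]))
  · have := γ.map_rel_iff (a := .inr i) (b := .inr j)
    rwa [hp, hp] at this
  · have := γ.map_rel_iff (a := .inl i) (b := .inr f)
    rw [hg, hp] at this
    exact this.symm
  · have := γ.map_rel_iff (a := .inr f) (b := .inl i)
    rw [hg, hp] at this
    exact this.symm

section
variable {φ : DigraphType ≃o DigraphType} {F : Type} [Finite F] {ρ : F → F → Prop}

theorem FixesSmall.exists_attach (hφ : FixesSmall φ) [Nonempty F] (hl : ∀ f, ¬ ρ f f)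
    (hρ : φ (ofRel ρ) = ofRel ρ) {m : ℕ} [NeZero m] (w : Fin m → F → Prop × Prop) :
    ∃ w' : Fin m → F → Prop × Prop, φ (ofRel (attach w ρ)) = ofRel (attach w' ρ) := by
  obtain ⟨W, _, _, s, h⟩ := exists_ofRel (φ (ofRel (attach w ρ)))
  obtain ⟨e⟩ := ofRel_le.1 ((le_iff_of_fixed h (hφ.chain m)).1 (ofRel_le.2 ⟨inlEmb w ρ⟩))
  obtain ⟨g⟩ := ofRel_le.1 ((le_iff_of_fixed h hρ).1 (ofRel_le.2 ⟨inrEmb w ρ⟩))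
  refine ⟨_, h.trans (ofRel_eq_attach e g (fun i f hif => hl f ?_) ?_).symm⟩
  · rw [← g.map_rel_iff, ← hif]
    exact e.map_rel_iff.2 le_rfl
  · rw [card_eq_of_map h, Nat.card_sum, Nat.card_fin]

theorem attach_le_iff_subword [Nonempty F] (hl : ∀ f, ¬ ρ f f)
    (hrigid : ∀ (f : ρ ↪r ρ) (x : F), f x = x) {k m : ℕ} (u : Fin k → F → Prop × Prop)
    (w : Fin m → F → Prop × Prop) :
    ofRel (attach u ρ) ≤ ofRel (attach w ρ) ↔ ∃ g : Fin k ↪o Fin m, ∀ i, u i = w (g i) := by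
  rw [ofRel_le]
  constructor
  · rintro ⟨γ⟩
    obtain ⟨g, p, -, -, h⟩ := exists_of_attach_emb hl hl γ
    refine ⟨g, fun i => funext fun f => ?_⟩
    rw [h, hrigid p]
  · rintro ⟨g, hg⟩
    obtain rfl : u = fun i f => w (g i) f := funext hg
    exact ⟨attachEmb w ρ g (.refl F)⟩

/-- By rigidity, embeddability is the subword order on words with letters in `F → Prop × Prop`.
Words of length at most two give at most four vertices; longer ones are reconstructed from subwords
fixed by induction. -/
theorem FixesSmall.attach_rigid (hφ : FixesSmall φ) [Nonempty F] (hl : ∀ f, ¬ ρ f f)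
    (hrigid : ∀ (f : ρ ↪r ρ) (x : F), f x = x) (hF : Nat.card F ≤ 2) (m : ℕ) :
    ∀ w : Fin m → F → Prop × Prop, φ (ofRel (attach w ρ)) = ofRel (attach w ρ) := by
  induction m with
  | zero => exact fun w => hφ _ (by rw [size_ofRel, Nat.card_sum, Nat.card_fin]; omega)
  | succ m ih =>
    intro w
    obtain hm | hm := Nat.lt_or_ge m 2
    · exact hφ _ (by rw [size_ofRel, Nat.card_sum, Nat.card_fin]; omega)
    obtain ⟨w', h⟩ := hφ.exists_attach hl (hφ _ (by rw [size_ofRel]; omega)) w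
    obtain rfl : w = w' := Fin.word_eq_of_subword_iff hm w w' fun u => by
      rw [← attach_le_iff_subword hl hrigid, ← attach_le_iff_subword hl hrigid]
      exact le_iff_of_fixed h (ih u)
    exact h

theorem FixesSmall.attach_empty (hφ : FixesSmall φ) [IsEmpty F] {m : ℕ} [NeZero m]
    (w : Fin m → F → Prop × Prop) : φ (ofRel (attach w ρ)) = ofRel (attach w ρ) := by
  have h : ofRel (fun i j : Fin m => i ≤ j) = ofRel (attach w ρ) :=
    eq_of_le_of_size_le (ofRel_le.2 ⟨inlEmb w ρ⟩) (by simp [size_ofRel])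
  rw [← h, hφ.chain]

end

section
variable {φ : DigraphType ≃o DigraphType}

/-- If the two core vertices are joined symmetrically, the core is invariant under their exchange,
and the two distinct columns, each visible in a fixed one-vertex attachment, determine everything.
Otherwise the core is rigid. -/
theorem FixesSmall.attach_fin_two (hφ : FixesSmall φ) {m : ℕ} [NeZero m]
    (w : Fin m → Fin 2 → Prop × Prop) (ρ : Fin 2 → Fin 2 → Prop) (hl : ∀ f, ¬ ρ f f)
    (hinj : ∀ f g, (∀ i, w i f = w i g) → f = g) :
    φ (ofRel (attach w ρ)) = ofRel (attach w ρ) := by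
  by_cases hs : ρ 0 1 ↔ ρ 1 0
  · obtain ⟨w', h⟩ := hφ.exists_attach hl (hφ _ (by simp [size_ofRel])) w
    have hcol : ∀ f, ∃ f', ∀ i, w i f = w' i f' := fun f => by
      have h1 : φ (ofRel (attach (fun i (_ : Unit) => w i f) fun _ _ => False)) =
          ofRel (attach (fun i (_ : Unit) => w i f) fun _ _ => False) :=
        hφ.attach_rigid (by simp) (by simp) (by simp) m _
      have h2 : ofRel (attach (fun i (_ : Unit) => w i f) fun _ _ => False) ≤
          ofRel (attach w ρ) := by
        have := attachEmb w ρ (RelEmbedding.refl _) ⟨fun _ : Unit => f, fun _ _ _ => rfl⟩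
        simp only [hl] at this
        exact ofRel_le.2 ⟨this⟩
      rw [le_iff_of_fixed h h1] at h2
      obtain ⟨γ⟩ := ofRel_le.1 h2
      obtain ⟨g, p, -, -, hg⟩ := exists_of_attach_emb (by simp) hl γ
      refine ⟨p (), fun i => ?_⟩
      rw [hg i (), chain_embedding_eq fun i j => g.map_rel_iff]
    choose σ hσ using hcol
    have hσi : Function.Injective σ := fun f g hfg => hinj f g fun i => by
      rw [hσ, hσ, hfg]
    have hρ : ρ = fun a b => ρ (σ a) (σ b) := by
      have h01 : ∀ a b : Fin 2, a ≠ b → (ρ a b ↔ ρ 0 1) := by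
        intro a b hab
        fin_cases a <;> fin_cases b <;> simp_all
      ext a b
      by_cases hab : a = b
      · subst hab
        simp [hl]
      · rw [h01 _ _ hab, h01 _ _ (hσi.ne hab)]
    obtain rfl : w = fun i f => w' i (σ f) := funext fun i => funext fun f => hσ f i
    rw [h]
    refine (eq_of_le_of_size_le (ofRel_le.2 ⟨?_⟩) (by simp [size_ofRel])).symm
    have := attachEmb w' ρ (RelEmbedding.refl _) ⟨σ, hσi⟩
    simp only [Function.Embedding.coeFn_mk, ← hρ] at this
    exact this
  · refine hφ.attach_rigid hl (fun f => ?_) (by simp) m w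
    have h01 : f 0 ≠ f 1 := f.injective.ne (by decide)
    have hr := f.map_rel_iff (a := 0) (b := 1)
    have h0 : f 0 = 0 ∧ f 1 = 1 := by
      generalize f 0 = a at *
      generalize f 1 = b at *
      fin_cases a <;> fin_cases b <;> simp_all
    intro x
    fin_cases x
    exacts [h0.1, h0.2]

theorem FixesSmall.attach_loopless_fin (hφ : FixesSmall φ) {m k : ℕ} [NeZero m] (hk : k ≤ 2)
    (w : Fin m → Fin k → Prop × Prop) (ρ : Fin k → Fin k → Prop) (hl : ∀ f, ¬ ρ f f)
    (hinj : ∀ f g, (∀ i, w i f = w i g) → f = g) :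
    φ (ofRel (attach w ρ)) = ofRel (attach w ρ) := by
  obtain rfl | rfl | rfl : k = 0 ∨ k = 1 ∨ k = 2 := by omega
  · exact hφ.attach_empty w
  · exact hφ.attach_rigid hl (fun f x => Subsingleton.elim _ _) (by simp) m w
  · exact hφ.attach_fin_two w ρ hl hinj

/-! ### Assembling a core from its pairs -/

/-- A core `F` attached to a chain is fixed if the chain is embedded only canonically, the vertices
of `F` are distinguished by the chain and their loops, and the same holds for every part of `F` with
at most two vertices. -/
theorem FixesSmall.attach_of_pairs (hφ : FixesSmall φ) {m : ℕ} [NeZero m] {F : Type} [Finite F]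
    (w : Fin m → F → Prop × Prop) (ρ : F → F → Prop)
    (huniq : ∀ (γ : (fun i j : Fin m => i ≤ j) ↪r attach w ρ) i, γ i = .inl i)
    (hinj : ∀ f g, (∀ i, w i f = w i g) → (ρ f f ↔ ρ g g) → f = g)
    (hpair : ∀ (k : ℕ) (p : Fin k ↪ F), k ≤ 2 →
      φ (ofRel (attach (fun i a => w i (p a)) fun a b => ρ (p a) (p b))) =
        ofRel (attach (fun i a => w i (p a)) fun a b => ρ (p a) (p b))) :
    φ (ofRel (attach w ρ)) = ofRel (attach w ρ) := by
  -- small extensions of the chain inside `attach w ρ` are fixed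
  have hfix : ∀ q ≤ ofRel (attach w ρ), ofRel (fun i j : Fin m => i ≤ j) ≤ q →
      size q ≤ m + 2 → φ q = q := by
    intro q hq hT hs
    obtain ⟨Q, _, _, q, rfl⟩ := exists_ofRel q
    obtain ⟨γ⟩ := ofRel_le.1 hq
    obtain ⟨c⟩ := ofRel_le.1 hT
    have hc : ∀ i, γ (c i) = .inl i := huniq (c.trans γ)
    let P : Set F := {f | .inr f ∈ Set.range γ}
    let p : Fin (Nat.card P) ↪ F := (Finite.equivFin P).symm.toEmbedding.trans (.subtype _)
    have hp : ∀ a, .inr (p a) ∈ Set.range γ := fun a => ((Finite.equivFin P).symm a).2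
    have hp' : ∀ f, .inr f ∈ Set.range γ → ∃ a, p a = f := fun f hf =>
      ⟨Finite.equivFin P ⟨f, hf⟩, congrArg Subtype.val ((Finite.equivFin P).symm_apply_apply _)⟩
    have hrange : ∀ x : Fin m ⊕ Fin (Nat.card P), ∃ y, γ y = Sum.map id p x := by
      rintro (i | a)
      · exact ⟨c i, hc i⟩
      · exact hp a
    choose β hβ using hrange
    have hβi : Function.Bijective β := by
      constructor
      · intro x y hxy
        have : Sum.map id p x = Sum.map id p y := by rw [← hβ, ← hβ, hxy]
        exact Sum.map_injective.2 ⟨Function.injective_id, p.injective⟩ this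
      · intro y
        rcases hy : γ y with i | f
        · exact ⟨.inl i, γ.injective (by rw [hβ, hy]; rfl)⟩
        · obtain ⟨a, rfl⟩ := hp' f ⟨y, hy⟩
          exact ⟨.inr a, γ.injective (by rw [hβ, hy]; rfl)⟩
    have hcard := Nat.card_congr (Equiv.ofBijective β hβi)
    rw [Nat.card_sum, Nat.card_fin, Nat.card_fin] at hcard
    rw [size_ofRel] at hs
    have heq : ofRel (attach (fun i a => w i (p a)) fun a b => ρ (p a) (p b)) = ofRel q := by
      refine ofRel_eq.2 ⟨⟨Equiv.ofBijective β hβi, fun {x y} => ?_⟩⟩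
      rw [Equiv.ofBijective_apply, Equiv.ofBijective_apply, ← γ.map_rel_iff, hβ, hβ]
      exact (attachEmb w ρ (RelEmbedding.refl _) p).map_rel_iff
    rw [← heq]
    exact hpair _ p (by omega)
  obtain ⟨W, _, _, s, h⟩ := exists_ofRel (φ (ofRel (attach w ρ)))
  obtain ⟨e⟩ := ofRel_le.1 ((le_iff_of_fixed h (hφ.chain m)).1 (ofRel_le.2 ⟨inlEmb w ρ⟩))
  -- The chain together with `z` and `z'` pulls back under `φ` to a small extension of the chain
  -- inside `attach w ρ`. That extension is fixed, so the chain with `z` and `z'` itself embeds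
  -- there, with the chain in canonical position.
  have hlocal : ∀ z z' : W, z ∉ Set.range e → z' ∉ Set.range e → ∃ f f' : F,
      (f = f' ↔ z = z') ∧ (ρ f f ↔ s z z) ∧ (ρ f' f' ↔ s z' z') ∧ (ρ f f' ↔ s z z') ∧
      (∀ i, w i f = (s (e i) z, s z (e i))) ∧ ∀ i, w i f' = (s (e i) z', s z' (e i)) := by
    intro z z' hz hz'
    let S : Set W := Set.range e ∪ {z, z'}
    have : Nonempty S := ⟨⟨z, by simp [S]⟩⟩
    have hS : Nat.card S ≤ m + 2 := by
      rw [Nat.card_coe_set_eq]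
      refine (Set.ncard_union_le _ _).trans (add_le_add ?_ ((Set.ncard_insert_le _ _).trans (by simp)))
      rw [← Nat.card_coe_set_eq, Nat.card_range_of_injective e.injective, Nat.card_fin]
    let q := ofRel fun a b : S => s a b
    have hq : q ≤ ofRel (attach w ρ) := by
      have h1 : φ.symm q ≤ ofRel (attach w ρ) := by
        rw [φ.symm_apply_le, h]
        exact ofRel_le.2 ⟨subEmb s S⟩
      have hT : ofRel (fun i j : Fin m => i ≤ j) ≤ q :=
        ofRel_le.2 ⟨⟨⟨fun i => ⟨e i, .inl ⟨i, rfl⟩⟩,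
          fun i j hij => e.injective (Subtype.ext_iff.1 hij)⟩, e.map_rel_iff⟩⟩
      have h2 : φ (φ.symm q) = φ.symm q := by
        refine hfix _ h1 ?_ (by rwa [size_map, size_ofRel])
        rwa [φ.le_symm_apply, hφ.chain]
      rw [φ.apply_symm_apply] at h2
      rwa [h2]
    obtain ⟨γ⟩ := ofRel_le.1 hq
    have hc : ∀ i, γ ⟨e i, .inl ⟨i, rfl⟩⟩ = .inl i :=
      huniq (⟨⟨fun i => γ ⟨e i, .inl ⟨i, rfl⟩⟩, fun i j hij =>
        e.injective (Subtype.ext_iff.1 (γ.injective hij))⟩, γ.map_rel_iff.trans e.map_rel_iff⟩)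
    have hF : ∀ y : S, y.1 ∉ Set.range e → ∃ f, γ y = .inr f := fun y hy => by
      rcases hx : γ y with i | f
      · rw [← hc] at hx
        exact absurd ⟨i, (Subtype.ext_iff.1 (γ.injective hx)).symm⟩ hy
      · exact ⟨f, rfl⟩
    obtain ⟨f, hf⟩ := hF ⟨z, by simp [S]⟩ hz
    obtain ⟨f', hf'⟩ := hF ⟨z', by simp [S]⟩ hz'
    refine ⟨f, f', ?_, ?_, ?_, ?_, fun i => Prod.ext (propext ?_) (propext ?_),
      fun i => Prod.ext (propext ?_) (propext ?_)⟩
    · rw [← Sum.inr_injective.eq_iff (f := Sum.inr (α := Fin m)), ← hf, ← hf',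
        γ.injective.eq_iff]
      exact Subtype.ext_iff
    · rw [← attach_inr_inr w ρ, ← hf, γ.map_rel_iff]
    · rw [← attach_inr_inr w ρ, ← hf', γ.map_rel_iff]
    · rw [← attach_inr_inr w ρ, ← hf, ← hf', γ.map_rel_iff]
    · rw [← attach_inl_inr w ρ, ← hf, ← hc, γ.map_rel_iff]
    · rw [← attach_inr_inl w ρ, ← hf, ← hc, γ.map_rel_iff]
    · rw [← attach_inl_inr w ρ, ← hf', ← hc, γ.map_rel_iff]
    · rw [← attach_inr_inl w ρ, ← hf', ← hc, γ.map_rel_iff]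
  have hchoice : ∀ z : ((Set.range e)ᶜ : Set W), ∃ f : F, (ρ f f ↔ s z z) ∧
      ∀ i, w i f = (s (e i) z, s z (e i)) := fun z => by
    obtain ⟨f, -, -, h1, -, -, h2, -⟩ := hlocal z z z.2 z.2
    exact ⟨f, h1, h2⟩
  choose β hβ hβw using hchoice
  have hβ' : ∀ z z' : ((Set.range e)ᶜ : Set W),
      (β z = β z' ↔ z = z') ∧ (ρ (β z) (β z') ↔ s z z') := fun z z' => by
    obtain ⟨f, f', h1, h2, h3, h4, h5, h6⟩ := hlocal z z' z.2 z'.2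
    -- Column and loop determine a core vertex, so the separate choices for pairs agree with the
    -- single map `β`.
    obtain rfl : β z = f := hinj _ _ (fun i => by rw [hβw, h5]) ((hβ z).trans h2.symm)
    obtain rfl : β z' = f' := hinj _ _ (fun i => by rw [hβw, h6]) ((hβ z').trans h3.symm)
    exact ⟨h1.trans Subtype.ext_iff.symm, h4⟩
  have hcard : Nat.card ((Set.range e)ᶜ : Set W) = Nat.card F := by
    have h1 := Set.ncard_add_ncard_compl (Set.range e)
    rw [← Nat.card_coe_set_eq, Nat.card_range_of_injective e.injective, Nat.card_fin,
      ← Nat.card_coe_set_eq, card_eq_of_map h, Nat.card_sum, Nat.card_fin] at h1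
    omega
  have hbij : Function.Bijective β :=
    (Nat.bijective_iff_injective_and_card β).2 ⟨fun z z' hz => (hβ' z z').1.1 hz, hcard⟩
  have hsymm : ∀ z, (Equiv.ofBijective β hbij).symm (β z) = z :=
    Equiv.ofBijective_symm_apply_apply β hbij
  let g : ρ ↪r s := ⟨⟨fun f => ((Equiv.ofBijective β hbij).symm f).1, fun f f' hf =>
    (Equiv.ofBijective β hbij).symm.injective (Subtype.ext hf)⟩, fun {f f'} => by
      obtain ⟨z, rfl⟩ := hbij.2 f
      obtain ⟨z', rfl⟩ := hbij.2 f'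
      rw [(hβ' z z').2]
      exact Iff.of_eq (congrArg₂ (fun a b : ((Set.range e)ᶜ : Set W) => s a b)
        (hsymm z) (hsymm z'))⟩
  have hg : ∀ z, g (β z) = z := fun z => congrArg Subtype.val (hsymm z)
  rw [h, ← ofRel_eq_attach e g (fun i f hif => ((Equiv.ofBijective β hbij).symm f).2 ⟨i, hif⟩)
    (by rw [card_eq_of_map h, Nat.card_sum, Nat.card_fin])]
  congr 2
  ext i f : 2
  obtain ⟨z, rfl⟩ := hbij.2 f
  rw [hg, hβw]

end

theorem emb_of_range_subset {U V W : Type} {q : U → U → Prop} {s : W → W → Prop}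
    {r : V → V → Prop} (a : q ↪r r) (b : s ↪r r) (h : ∀ u, ∃ w, b w = a u) :
    Nonempty (q ↪r s) := by
  choose f hf using h
  exact ⟨⟨⟨f, fun u v huv => a.injective (by rw [← hf, ← hf, huv])⟩, fun {u v} => by
    rw [← a.map_rel_iff, ← hf, ← hf]
    exact b.map_rel_iff.symm⟩⟩

theorem chain_emb_eq_inl {m : ℕ} {F : Type} {w : Fin m → F → Prop × Prop} {ρ : F → F → Prop}
    (γ : (fun i j : Fin m => i ≤ j) ↪r attach w ρ) (h : ∀ i, ∃ j, γ i = .inl j) (i : Fin m) :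
    γ i = .inl i := by
  choose f hf using h
  refine (hf i).trans (congrArg _ (chain_embedding_eq (fun i j => ?_) i))
  rw [← attach_inl_inl w ρ, ← hf, ← hf]
  exact γ.map_rel_iff

/-- Looped core vertices are joined symmetrically to the chain, while distinct vertices of a chain
are not joined symmetrically. So if one vertex is sent into the core, all are, and the core has too
few loops for that. -/
theorem chain_emb_eq_inl_of_card {m : ℕ} {F : Type} [Finite F] {w : Fin m → F → Prop × Prop}
    {ρ : F → F → Prop} (hw : ∀ f, ρ f f → ∀ i, (w i f).1 ↔ (w i f).2)
    (hcard : Nat.card {f // ρ f f} < m)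
    (γ : (fun i j : Fin m => i ≤ j) ↪r attach w ρ) (i : Fin m) : γ i = .inl i := by
  refine chain_emb_eq_inl γ (fun i₀ => ?_) i
  rcases h₀ : γ i₀ with j | b
  · exact ⟨j, rfl⟩
  exfalso
  have hloop : ∀ i f, γ i = .inr f → ρ f f := fun i f hf => by
    have := (γ.map_rel_iff (a := i) (b := i)).2 le_rfl
    rwa [hf] at this
  have hall : ∀ i, ∃ f : {f // ρ f f}, γ i = .inr f.1 := fun i => by
    rcases hi : γ i with j | f
    · exfalso
      have h1 := γ.map_rel_iff (a := i) (b := i₀)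
      have h2 := γ.map_rel_iff (a := i₀) (b := i)
      rw [hi, h₀] at h1 h2
      have h3 := hw b (hloop _ _ h₀) j
      simp only [attach_inl_inr, attach_inr_inl] at h1 h2
      have hii : i = i₀ := by
        rcases le_total i i₀ with hle | hle
        · exact le_antisymm hle (h2.1 (h3.1 (h1.2 hle)))
        · exact le_antisymm (h1.1 (h3.2 (h2.2 hle))) hle
      rw [hii, h₀] at hi
      cases hi
    · exact ⟨⟨f, hloop _ _ hi⟩, rfl⟩
  choose g hg using hall
  have := Nat.card_le_card_of_injective g fun i j hij => γ.injective (by rw [hg, hg, hij])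
  rw [Nat.card_fin] at this
  omega

/-! ### Loopless digraphs -/

section
variable {φ : DigraphType ≃o DigraphType}

theorem FixesSmall.loopless_of_map (hφ : FixesSmall φ) {V W : Type} [Finite V] [Nonempty V]
    [Finite W] [Nonempty W] {r : V → V → Prop} {s : W → W → Prop} (h : φ (ofRel r) = ofRel s)
    (hr : ∀ v, ¬ r v v) (z : W) : ¬ s z z := by
  obtain ⟨q, -, hq⟩ := hφ.exists_local h (ι := Unit) (by simp) fun _ => z
  exact mt (hq () ()).2 (hr _)

/-- Digraphs without loops are fixed. -/
theorem FixesSmall.loopless (hφ : FixesSmall φ) {F : Type} [Finite F] [Nonempty F]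
    (ρ : F → F → Prop) (hl : ∀ f, ¬ ρ f f) : φ (ofRel ρ) = ofRel ρ := by
  have : NeZero (Nat.card F) := ⟨Nat.card_pos.ne'⟩
  let e := Finite.equivFin F
  -- Each core vertex receives an edge from its own chain vertex only, so the columns are distinct.
  let w : Fin (Nat.card F) → F → Prop × Prop := fun i f => (i = e f, False)
  have hw : ∀ f g, (∀ i, w i f = w i g) → f = g := fun f g hfg => by
    have := hfg (e f)
    simpa [w] using this
  have hfix : φ (ofRel (attach w ρ)) = ofRel (attach w ρ) := by
    refine hφ.attach_of_pairs w ρ (fun γ i => chain_emb_eq_inl γ (fun i => ?_) i)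
      (fun f g hfg _ => hw f g hfg) fun k p hk =>
        hφ.attach_loopless_fin hk _ _ (fun _ => hl _) fun f g hfg => p.injective (hw _ _ hfg)
    have := (γ.map_rel_iff (a := i) (b := i)).2 le_rfl
    rcases hx : γ i with j | f
    · exact ⟨j, rfl⟩
    · rw [hx] at this
      exact absurd this (hl f)
  obtain ⟨W, _, _, s, h⟩ := exists_ofRel (φ (ofRel ρ))
  have hle : ofRel s ≤ ofRel (attach w ρ) := by
    rw [← h, ← hfix, φ.le_iff_le]
    exact ofRel_le.2 ⟨inrEmb w ρ⟩
  obtain ⟨γ⟩ := ofRel_le.1 hle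
  rw [h]
  refine eq_of_le_of_size_le (ofRel_le.2 (emb_of_range_subset γ (inrEmb w ρ) fun z => ?_))
    (card_eq_of_map h).ge
  have := mt γ.map_rel_iff.1 (hφ.loopless_of_map h hl z)
  rcases hx : γ z with j | f
  · rw [hx] at this
    exact absurd le_rfl this
  · exact ⟨f, rfl⟩

end

/-! ### Complementing loops -/

/-- Complementing the loops of a relation. -/
def swapRel {V : Type} (r : V → V → Prop) (a b : V) : Prop := (a = b ∧ ¬ r a b) ∨ (a ≠ b ∧ r a b)

@[simp] theorem swapRel_self {V : Type} (r : V → V → Prop) (a : V) : swapRel r a a ↔ ¬ r a a := by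
  simp [swapRel]

theorem swapRel_swapRel {V : Type} (r : V → V → Prop) : swapRel (swapRel r) = r := by
  ext a b
  by_cases h : a = b <;> simp [swapRel, h]

def swapEmb {V W : Type} {r : V → V → Prop} {s : W → W → Prop} (f : r ↪r s) :
    swapRel r ↪r swapRel s :=
  ⟨f.toEmbedding, fun {a b} => by
    have := f.map_rel_iff (a := a) (b := b)
    simp [swapRel, this]⟩

def swapFun : DigraphType → DigraphType :=
  Quotient.map (fun G => { V := G.V, graph := ⟨swapRel G.graph.Adj⟩ }) fun _ _ ⟨e⟩ =>
    ⟨⟨e.toEquiv, (swapEmb e.toRelEmbedding).map_rel_iff⟩⟩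

section
variable {V : Type} [Finite V] [Nonempty V] (r : V → V → Prop)

theorem swapFun_ofRel : swapFun (ofRel r) = ofRel (swapRel r) := rfl

theorem swapFun_swapFun (x : DigraphType) : swapFun (swapFun x) = x := by
  obtain ⟨V, _, _, r, rfl⟩ := exists_ofRel x
  rw [swapFun_ofRel, swapFun_ofRel, swapRel_swapRel]

theorem swapFun_mono {x y : DigraphType} (h : x ≤ y) : swapFun x ≤ swapFun y := by
  obtain ⟨V, _, _, r, rfl⟩ := exists_ofRel x
  obtain ⟨W, _, _, s, rfl⟩ := exists_ofRel y
  exact ofRel_le.2 ((ofRel_le.1 h).map swapEmb)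

/-- The automorphism of the poset that complements the loops. -/
def swapLoops : DigraphType ≃o DigraphType where
  toFun := swapFun
  invFun := swapFun
  left_inv := swapFun_swapFun
  right_inv := swapFun_swapFun
  map_rel_iff' {x y} := ⟨fun h => by
    simpa only [Equiv.coe_fn_mk, swapFun_swapFun] using swapFun_mono h, swapFun_mono⟩

theorem swapLoops_swapLoops (x : DigraphType) : swapLoops (swapLoops x) = x := swapFun_swapFun x

theorem FixesSmall.conj_swapLoops {φ : DigraphType ≃o DigraphType} (hφ : FixesSmall φ) :
    FixesSmall (swapLoops.trans (φ.trans swapLoops)) := fun x hx => by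
  simp only [OrderIso.trans_apply]
  rw [hφ _ (by rwa [size_map]), swapLoops_swapLoops]

theorem fixed_of_swapLoops {φ : DigraphType ≃o DigraphType}
    (h : swapLoops.trans (φ.trans swapLoops) (ofRel (swapRel r)) = ofRel (swapRel r)) :
    φ (ofRel r) = ofRel r := by
  have h1 : swapLoops (ofRel r) = ofRel (swapRel r) := rfl
  simp only [OrderIso.trans_apply] at h
  rw [← h1, swapLoops_swapLoops] at h
  exact swapLoops.injective h

/-- Digraphs with all loops are fixed. -/
theorem FixesSmall.looped {φ : DigraphType ≃o DigraphType} (hφ : FixesSmall φ)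
    (hr : ∀ v, r v v) : φ (ofRel r) = ofRel r :=
  fixed_of_swapLoops r (hφ.conj_swapLoops.loopless _ fun v => by simp [hr])

end

/-! ### Mixed pairs and cones -/

section
variable {φ : DigraphType ≃o DigraphType}

/-- The chain with `y` has all loops and the chain with `x` has a rigid core, so both are fixed and
give the columns. The edges between `x` and `y` are read off from four vertices. -/
theorem FixesSmall.attach_loopless_looped (hφ : FixesSmall φ) {m : ℕ} [NeZero m] (hm : 2 ≤ m)
    {F : Type} [Finite F] {w : Fin m → F → Prop × Prop} {ρ : F → F → Prop} {x y : F}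
    (hxy : ∀ f, f = x ∨ f = y) (hx : ¬ ρ x x) (hy : ρ y y) (hw : ∀ i, (w i y).1 ↔ (w i y).2) :
    φ (ofRel (attach w ρ)) = ofRel (attach w ρ) := by
  classical
  obtain ⟨W, _, _, s, h⟩ := exists_ofRel (φ (ofRel (attach w ρ)))
  have hyle : ofRel (attach (fun i (_ : Unit) => w i y) fun _ _ => True) ≤ ofRel s := by
    rw [← le_iff_of_fixed h (hφ.looped _ (by rintro (i | f) <;> simp))]
    have this : attach (fun i (_ : Unit) => w i y) (fun _ _ => ρ y y) ↪r attach w ρ :=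
      attachEmb w ρ (RelEmbedding.refl _) ⟨fun _ : Unit => y, fun _ _ _ => rfl⟩
    simp only [hy] at this
    exact ofRel_le.2 ⟨this⟩
  obtain ⟨κ⟩ := ofRel_le.1 hyle
  have hxle : ofRel (fun _ _ : Unit => False) ≤ ofRel s := by
    rw [← le_iff_of_fixed h (hφ.loopless _ (by simp))]
    exact ofRel_le.2 ⟨⟨⟨fun _ => .inr x, fun _ _ _ => rfl⟩, iff_of_false hx id⟩⟩
  obtain ⟨ζ⟩ := ofRel_le.1 hxle
  have hz : ¬ s (ζ ()) (ζ ()) := mt ζ.map_rel_iff.1 id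
  have hκ : ∀ v, s (κ v) (κ v) := fun v => κ.map_rel_iff.2 (by rcases v with i | f <;> simp)
  have hne : ∀ v, κ v ≠ ζ () := fun v hv => hz (hv ▸ hκ v)
  have hxy' : y ≠ x := fun h => hx (h ▸ hy)
  let g : F → W := fun f => if f = x then ζ () else κ (.inr ())
  have hgx : g x = ζ () := if_pos rfl
  have hgy : g y = κ (.inr ()) := if_neg hxy'
  have hg : Function.Injective g := fun a b hab => by
    rcases hxy a with rfl | rfl <;> rcases hxy b with rfl | rfl
    · rfl
    · rw [hgx, hgy] at hab
      exact absurd hab.symm (hne _)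
    · rw [hgx, hgy] at hab
      exact absurd hab (hne _)
    · rfl
  have hs := ofRel_eq_attach (s := s) (ρ := fun a b => s (g a) (g b)) ((inlEmb _ _).trans κ)
    ⟨⟨g, hg⟩, Iff.rfl⟩ (fun i f => by
      rcases hxy f with rfl | rfl
      · simpa [hgx] using hne _
      · simp [hgy]) (by rw [card_eq_of_map h, Nat.card_sum, Nat.card_fin])
  rw [← hs] at h
  clear hs
  simp only [RelEmbedding.coe_trans, Function.comp_apply, inlEmb_apply, RelEmbedding.coe_mk,
    Function.Embedding.coeFn_mk] at h
  set w' : Fin m → F → Prop × Prop := fun i f => (s (κ (.inl i)) (g f), s (g f) (κ (.inl i)))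
    with hw'
  set ρ' : F → F → Prop := fun a b => s (g a) (g b) with hρ'
  have hx' : ¬ ρ' x x := by simpa [hρ', hgx] using hz
  have hy' : ρ' y y := by simpa [hρ', hgy] using hκ _
  have hwy : ∀ i, w' i y = w i y := fun i => by
    simp only [hw', hgy, κ.map_rel_iff]
    rfl
  have hwx : ∀ i, w' i x = w i x := by
    have h1 : φ (ofRel (attach (fun i (_ : Unit) => w i x) fun _ _ => False)) =
        ofRel (attach (fun i (_ : Unit) => w i x) fun _ _ => False) :=
      hφ.attach_rigid (by simp) (by simp) (by simp) m _
    have h2 : ofRel (attach (fun i (_ : Unit) => w i x) fun _ _ => False) ≤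
        ofRel (attach w ρ) := by
      have this : attach (fun i (_ : Unit) => w i x) (fun _ _ => ρ x x) ↪r attach w ρ :=
      attachEmb w ρ (RelEmbedding.refl _) ⟨fun _ : Unit => x, fun _ _ _ => rfl⟩
      simp only [hx] at this
      exact ofRel_le.2 ⟨this⟩
    rw [le_iff_of_fixed h h1] at h2
    obtain ⟨γ⟩ := ofRel_le.1 h2
    have hγ : ∀ i, γ (.inl i) = .inl i := by
      refine chain_emb_eq_inl_of_card (fun f hf i => ?_) ?_ ((inlEmb _ _).trans γ)
      · rcases hxy f with rfl | rfl
        · exact absurd hf hx'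
        · rw [hwy, hw]
      · have : Subsingleton {f // ρ' f f} := ⟨fun a b => Subtype.ext <| by
          have h1 := (hxy a).resolve_left fun h => hx' (h ▸ a.2)
          have h2 := (hxy b).resolve_left fun h => hx' (h ▸ b.2)
          rw [h1, h2]⟩
        exact Finite.card_le_one_iff_subsingleton.2 this |>.trans_lt hm
    have hγx : γ (.inr ()) = .inr x := by
      have := mt (γ.map_rel_iff (a := .inr ()) (b := .inr ())).1 id
      rcases hc : γ (.inr ()) with j | f
      · rw [hc] at this
        exact absurd le_rfl this
      · rw [hc] at this
        rcases hxy f with rfl | rfl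
        · rfl
        · exact absurd hy' this
    intro i
    have h3 := γ.map_rel_iff (a := .inl i) (b := .inr ())
    have h4 := γ.map_rel_iff (a := .inr ()) (b := .inl i)
    rw [hγ, hγx] at h3 h4
    exact Prod.ext (propext h3) (propext h4)
  have hloc : (ρ x y ↔ ρ' x y) ∧ (ρ y x ↔ ρ' y x) := by
    -- Two chain vertices are needed to recognise `y`: it is the looped vertex joined symmetrically
    -- to both, whereas a chain vertex is joined symmetrically to no other looped vertex except
    -- possibly `y`.
    obtain ⟨q, hq, hr⟩ := hφ.exists_local h (ι := Fin 4) (by simp)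
      ![.inl ⟨0, by omega⟩, .inl ⟨1, by omega⟩, .inr x, .inr y]
    have h01 : q 0 ≠ q 1 := by simp [hq]
    have h03 : q 0 ≠ q 3 := by simp [hq]
    have h13 : q 1 ≠ q 3 := by simp [hq]
    have r00 : attach w ρ (q 0) (q 0) := by simp [hr]
    have r11 : attach w ρ (q 1) (q 1) := by simp [hr]
    have r22 : ¬ attach w ρ (q 2) (q 2) := by simp [hr, hx']
    have r33 : attach w ρ (q 3) (q 3) := by simp [hr, hy']
    have r03 : attach w ρ (q 0) (q 3) ↔ attach w ρ (q 3) (q 0) := by simp [hr, hwy, hw]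
    have r13 : attach w ρ (q 1) (q 3) ↔ attach w ρ (q 3) (q 1) := by simp [hr, hwy, hw]
    have q2 : q 2 = .inr x := by
      rcases hc : q 2 with j | f
      · simp [hc] at r22
      · rcases hxy f with rfl | rfl
        · rfl
        · simp [hc, hy] at r22
    have q3 : q 3 = .inr y := by
      rcases hc : q 3 with j | f
      · exfalso
        have aux : ∀ v, v ≠ q 3 → attach w ρ v v →
            (attach w ρ v (q 3) ↔ attach w ρ (q 3) v) → v = .inr y := by
          rintro (j' | f) hv hvv hsym
          · rw [hc] at hsym hv
            simp only [attach_inl_inl] at hsym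
            refine absurd ?_ hv
            rcases le_total j j' with hle | hle
            · rw [le_antisymm hle (hsym.2 hle)]
            · rw [le_antisymm hle (hsym.1 hle)]
          · rcases hxy f with rfl | rfl
            · exact absurd hvv hx
            · rfl
        exact h01 ((aux _ h03 r00 r03).trans (aux _ h13 r11 r13).symm)
      · rcases hxy f with rfl | rfl
        · rw [hc] at r33
          exact absurd r33 hx
        · rfl
    have h23 := hr 2 3
    have h32 := hr 3 2
    rw [q2, q3] at h23 h32
    exact ⟨h23, h32⟩
  have ew : w' = w := by
    ext i f : 2
    rcases hxy f with rfl | rfl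
    exacts [hwx i, hwy i]
  have eρ : ρ' = ρ := by
    ext a b
    rcases hxy a with rfl | rfl <;> rcases hxy b with rfl | rfl
    exacts [iff_of_false hx' hx, hloc.1.symm, hloc.2.symm, iff_of_true hy' hy]
  rw [h, ew, eρ]

theorem FixesSmall.cone (hφ : FixesSmall φ) {F : Type} [Finite F] [Nonempty F]
    {ρ : F → F → Prop} (hl : ∀ f, ¬ ρ f f) (c : Prop × Prop) :
    φ (ofRel (attach (fun (_ : Fin 1) _ => c) ρ)) = ofRel (attach (fun (_ : Fin 1) _ => c) ρ) := by
  obtain ⟨w, h⟩ := hφ.exists_attach hl (hφ.loopless ρ hl) fun (_ : Fin 1) _ => c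
  rw [h]
  congr 2
  ext i f : 2
  obtain ⟨q, hq, hr⟩ := hφ.exists_local h (ι := Fin 2) (by simp) ![.inl i, .inr f]
  have r00 := hr 0 0
  have r11 := hr 1 1
  have r01 := hr 0 1
  have r10 := hr 1 0
  rcases h0 : q 0 with j | f0
  · rcases h1 : q 1 with j | f1
    · simp [h1, hl] at r11
    · rw [h0, h1] at r01 r10
      exact Prod.ext (propext r01.symm) (propext r10.symm)
  · simp [h0, hl] at r00

end

/-! ### Counting and separating families -/

/-- The bound on the sum forces `a₀ b = k` and `a t b = n - k`, so each `b` realizes at most one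
pair `(k, t)`. There are `2 * (n - 1)` pairs, more than `n` when `3 ≤ n`. -/
theorem exists_unrealized_count {B : Type} [Finite B] {n : ℕ} (hn : 3 ≤ n) (hB : Nat.card B ≤ n)
    (a₀ : B → ℕ) (a : Bool → B → ℕ) (h : ∀ b, a₀ b + a false b + a true b ≤ n) :
    ∃ (k : ℕ) (t : Bool), 0 < k ∧ k < n ∧ ∀ b, k ≤ a₀ b → n - k ≤ a t b → False := by
  by_contra! hcon
  have hex : ∀ p : Fin (n - 1) × Bool, ∃ b, p.1 + 1 ≤ a₀ b ∧ n - (p.1 + 1) ≤ a p.2 b :=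
    fun p => by
      obtain ⟨b, h1, h2, -⟩ := hcon (p.1 + 1) p.2 (by omega) (by omega)
      exact ⟨b, h1, h2⟩
  choose f hf using hex
  have hinj : Function.Injective f := by
    rintro ⟨k, t⟩ ⟨k', t'⟩ hff
    have h1 := hf (k, t)
    have h2 := hf (k', t')
    have h3 := h (f (k, t))
    rw [← hff] at h2
    have := k.2
    have := k'.2
    cases t <;> cases t' <;> simp only [Prod.mk.injEq, Fin.ext_iff, and_true, reduceCtorEq,
      and_false] at * <;> omega
  have := Nat.card_le_card_of_injective f hinj
  rw [Nat.card_prod, Nat.card_fin, Nat.card_eq_fintype_card, Fintype.card_bool] at this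
  omega

/-- All `k`-subsets are taken, each repeated `N` times to make the family long enough. -/
theorem exists_family {A : Type} [Finite A] {k : ℕ} (h0 : 0 < k) (hk : k < Nat.card A) {N : ℕ}
    (hN : 0 < N) :
    ∃ (m : ℕ) (S : Fin m → Finset A), N ≤ m ∧ (∀ i, (S i).card = k) ∧
      ∀ f g, f ≠ g → ∃ i, f ∈ S i ∧ g ∉ S i := by
  classical
  have : Fintype A := Fintype.ofFinite A
  rw [Nat.card_eq_fintype_card] at hk
  obtain ⟨T, -, hT⟩ := Finset.exists_subset_card_eq (s := (Finset.univ : Finset A)) (n := k) hk.le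
  let e := Finite.equivFin ({S : Finset A // S.card = k} × Fin N)
  refine ⟨_, fun i => (e.symm i).1.1, ?_, fun i => (e.symm i).1.2, fun f g hfg => ?_⟩
  · have : Nonempty {S : Finset A // S.card = k} := ⟨⟨T, hT⟩⟩
    rw [Nat.card_prod, Nat.card_fin]
    exact Nat.le_mul_of_pos_left _ Nat.card_pos
  · obtain ⟨T, h1, h2, h3⟩ := Finset.exists_subsuperset_card_eq (s := {f})
      (t := Finset.univ.erase g) (n := k) (by simpa using hfg)
      (by rw [Finset.card_singleton]; exact h0)
      (by rw [Finset.card_erase_of_mem (Finset.mem_univ _), Finset.card_univ]; omega)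
    refine ⟨e (⟨T, h3⟩, ⟨0, ?_⟩), ?_⟩
    · exact hN
    · simp only [e.symm_apply_apply]
      exact ⟨h1 (by simp), fun hg => by simpa using h2 hg⟩

theorem card_fibers_le {F L : Type} [Finite F] (P : F → Prop) (f : F → L) {l₀ l₁ l₂ : L}
    (h01 : l₀ ≠ l₁) (h02 : l₀ ≠ l₂) (h12 : l₁ ≠ l₂) :
    Nat.card {a // P a ∧ f a = l₀} + Nat.card {a // P a ∧ f a = l₁} +
      Nat.card {a // P a ∧ f a = l₂} ≤ Nat.card {a // P a} := by
  let g (l : L) (a : {a // P a ∧ f a = l}) : {a // P a} := ⟨a, a.2.1⟩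
  have hi : ∀ l, Function.Injective (g l) := fun l a b h =>
    Subtype.ext (congrArg (fun x : {a // P a} => x.1) h)
  have hd : ∀ l l', l ≠ l' → ∀ a b, g l a ≠ g l' b := fun l l' h a b hab => h <| by
    rw [← a.2.2, ← b.2.2, show a.1 = b.1 from congrArg (fun x : {a // P a} => x.1) hab]
  have := Nat.card_le_card_of_injective _ (((hi l₀).sumElim (hi l₁) (hd _ _ h01)).sumElim (hi l₂)
    (by
      rintro (a | a) b
      exacts [hd _ _ h02 a b, hd _ _ h12 a b]))
  rwa [Nat.card_sum, Nat.card_sum] at this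

theorem eq_of_loops {Q E : Type} [Finite Q] [Finite E] {q : Q → Q → Prop} {τ : E → E → Prop}
    (hτ : ∀ e, ¬ τ e e) (α : τ ↪r q) (hQ : Nat.card Q ≤ Nat.card E + 1) {u v : Q} (hu : q u u)
    (hv : q v v) : u = v := by
  by_contra hne
  have hα : ∀ e x, q x x → α e ≠ x := fun e x hx h =>
    hτ e (α.map_rel_iff.1 (by rwa [h]))
  have huv : Function.Injective (fun o : Bool => bif o then u else v) := by
    intro o o' h
    cases o <;> cases o'
    exacts [rfl, absurd h.symm hne, absurd h hne, rfl]
  have := Nat.card_le_card_of_injective _ (α.injective.sumElim huv (by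
    rintro e (_ | _)
    exacts [hα e v hv, hα e u hu]))
  rw [Nat.card_sum, Nat.card_eq_fintype_card (α := Bool), Fintype.card_bool] at this
  omega

/-! ### Digraphs with some loops -/

section
variable {φ : DigraphType ≃o DigraphType} {F : Type} [Finite F]

theorem card_le_of_cone {E : Type} [Finite E] {c : Prop × Prop} {τ : E → E → Prop}
    (hτ : ∀ e, ¬ τ e e) {ρ : F → F → Prop} (κ : attach (fun (_ : Fin 1) _ => c) τ ↪r ρ) :
    Nat.card E ≤ Nat.card {a : F // ¬ ρ a a ∧ (ρ (κ (.inl 0)) a, ρ a (κ (.inl 0))) = c} := by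
  refine Nat.card_le_card_of_injective (fun e => ⟨κ (.inr e), mt κ.map_rel_iff.1 (hτ e), ?_⟩) ?_
  · exact Prod.ext (propext κ.map_rel_iff) (propext κ.map_rel_iff)
  · exact fun e e' h => Sum.inr_injective (κ.injective (Subtype.ext_iff.1 h))

/-- Digraphs with at least three vertices without loops, and not more vertices with a loop, are
fixed. -/
theorem FixesSmall.fixed_of_card_le (hφ : FixesSmall φ) [Nonempty F] (ρ : F → F → Prop)
    (h3 : 3 ≤ Nat.card {f // ¬ ρ f f})
    (hle : Nat.card {f // ρ f f} ≤ Nat.card {f // ¬ ρ f f}) : φ (ofRel ρ) = ofRel ρ := by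
  classical
  set n := Nat.card {f // ¬ ρ f f} with hn
  let A := {f // ¬ ρ f f}
  have hA : Nat.card A = n := rfl
  have : Nonempty A := (Nat.card_pos_iff.1 (by omega : 0 < Nat.card A)).1
  let cnt : Prop × Prop → F → ℕ := fun c b => Nat.card {a : F // ¬ ρ a a ∧ (ρ b a, ρ a b) = c}
  let s : Prop × Prop := (False, False)
  let t' : Bool → Prop × Prop := fun o => (o = true, o = false)
  have hst : ∀ o, s ≠ t' o := fun o h => by
    cases o <;> simp [s, t'] at h
  have htt : t' false ≠ t' true := fun h => by simp [t'] at h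
  -- No looped vertex has at least `k` loopless vertices in relation `s` to it and at least `n - k`
  -- in relation `t' o`. Every chain vertex will have exactly these counts.
  obtain ⟨k, o, hk0, hkn, hcnt⟩ := exists_unrealized_count h3 hle (fun b => cnt s b)
    (fun o b => cnt (t' o) b) fun b =>
      card_fibers_le _ _ (hst _) (hst _) htt
  set t := t' o
  obtain ⟨m, S, hm, hSk, hS⟩ := exists_family hk0 hkn (Nat.card F + 1).succ_pos
  have : NeZero m := ⟨by omega⟩
  obtain ⟨ι⟩ : Nonempty (F ↪ Fin m) := by
    have : Fintype F := Fintype.ofFinite F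
    refine Function.Embedding.nonempty_of_card_le ?_
    rw [Fintype.card_fin, ← Nat.card_eq_fintype_card]
    omega
  let w : Fin m → F → Prop × Prop := fun i f =>
    if h : ρ f f then (i = ι f, i = ι f) else if (⟨f, h⟩ : A) ∈ S i then s else t
  have hwl : ∀ f, ρ f f → ∀ i, w i f = (i = ι f, i = ι f) := fun f hf i => dif_pos hf
  have hwn : ∀ (f : A) i, w i f = if f ∈ S i then s else t := fun f i => dif_neg f.2
  have hsym : ∀ f, ρ f f → ∀ i, (w i f).1 ↔ (w i f).2 := fun f hf i => by rw [hwl f hf]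
  have hinj : ∀ f g, (∀ i, w i f = w i g) → (ρ f f ↔ ρ g g) → f = g := by
    intro f g hfg hρ
    by_cases hf : ρ f f
    · have := hfg (ι f)
      rw [hwl f hf, hwl g (hρ.1 hf)] at this
      simpa using this
    · by_contra hne
      obtain ⟨i, h1, h2⟩ := hS ⟨f, hf⟩ ⟨g, mt hρ.2 hf⟩ (by simpa using hne)
      have := hfg i
      rw [hwn ⟨f, hf⟩, hwn ⟨g, mt hρ.2 hf⟩, if_pos h1, if_neg h2] at this
      exact hst o this
  have hfix : φ (ofRel (attach w ρ)) = ofRel (attach w ρ) := by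
    refine hφ.attach_of_pairs w ρ (chain_emb_eq_inl_of_card hsym ?_) hinj fun k p hk => ?_
    · have := Finite.card_subtype_le fun f => ρ f f
      omega
    by_cases hall : ∀ a, ρ (p a) (p a)
    · exact hφ.looped _ (by rintro (i | a) <;> simp [hall])
    push Not at hall
    obtain ⟨x, hx⟩ := hall
    by_cases hnone : ∀ a, ¬ ρ (p a) (p a)
    · exact hφ.attach_loopless_fin hk _ _ hnone fun f g hfg =>
        p.injective (hinj _ _ hfg (iff_of_false (hnone f) (hnone g)))
    push Not at hnone
    obtain ⟨y, hy⟩ := hnone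
    refine hφ.attach_loopless_looped (by omega) (x := x) (y := y) (fun a => ?_) hx hy
      fun i => hsym _ hy i
    have : x ≠ y := fun h => hx (h ▸ hy)
    omega
  let ρA : A → A → Prop := fun a b => ρ a b
  have hρA : ∀ a, ¬ ρA a a := fun a => a.2
  have hAfix : φ (ofRel ρA) = ofRel ρA := hφ.loopless ρA hρA
  obtain ⟨W, _, _, r, h⟩ := exists_ofRel (φ (ofRel ρ))
  obtain ⟨γ⟩ : Nonempty (r ↪r attach w ρ) := by
    rw [← ofRel_le, ← h, ← hfix, φ.le_iff_le]
    exact ofRel_le.2 ⟨inrEmb w ρ⟩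
  obtain ⟨α⟩ := ofRel_le.1 ((le_iff_of_fixed h hAfix).1 (ofRel_le.2 ⟨subEmb ρ {f | ¬ ρ f f}⟩))
  have hγα : ∀ a : A, ∃ z, γ z = .inr a.1 := by
    have : ∀ a : A, ∃ b : A, γ (α a) = .inr b.1 := fun a => by
      have := mt γ.map_rel_iff.1 (mt α.map_rel_iff.1 a.2)
      rcases hx : γ (α a) with j | f
      · rw [hx] at this
        exact absurd le_rfl this
      · rw [hx] at this
        exact ⟨⟨f, this⟩, rfl⟩
    choose β hβ using this
    have hβi : Function.Injective β := fun a b hab =>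
      α.injective (γ.injective (by rw [hβ, hβ, hab]))
    intro a
    obtain ⟨b, rfl⟩ := Finite.injective_iff_surjective.1 hβi a
    exact ⟨α b, hβ b⟩
  -- All loopless vertices of `attach w ρ` are already in the image of `γ`. If the image lies in the
  -- core, sizes finish; otherwise it contains a chain vertex `i`, which is to be refuted.
  by_cases hC : ∀ z, ∃ f, γ z = .inr f
  · rw [h]
    exact eq_of_le_of_size_le (ofRel_le.2 (emb_of_range_subset γ (inrEmb w ρ) fun z =>
      (hC z).imp fun f hf => hf.symm)) (card_eq_of_map h).ge
  exfalso
  push Not at hC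
  obtain ⟨z, hz⟩ := hC
  obtain ⟨i, hi⟩ : ∃ i, γ z = .inl i := by
    rcases hx : γ z with i | f
    · exact ⟨i, rfl⟩
    · exact absurd hx (hz f)
  -- the vertices without loops together with one vertex of the chain
  let wi : Fin 1 → A → Prop × Prop := fun _ a => w i a
  have hZ : ofRel (attach wi ρA) ≤ ofRel r := by
    refine ofRel_le.2 (emb_of_range_subset (attachEmb w ρ ⟨⟨fun _ : Fin 1 => i, fun _ _ _ =>
      Subsingleton.elim _ _⟩, by simp [Subsingleton.elim _ (0 : Fin 1)]⟩ (.subtype _)) γ ?_)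
    rintro (j | a)
    · exact ⟨z, hi⟩
    · exact hγα a
  -- The preimage `q` lies below `ρ` and has `n` loopless vertices and one more. The cones over `S
  -- i` and its complement are fixed, so both embed in `q`, with the same apex since only one vertex
  -- can have a loop. This apex shows in `ρ` the counts excluded by `hcnt`.
  obtain ⟨Q, _, _, q, hq⟩ := exists_ofRel (φ.symm (ofRel (attach wi ρA)))
  have hq' : φ (ofRel q) = ofRel (attach wi ρA) := by rw [← hq, φ.apply_symm_apply]
  obtain ⟨δ⟩ : Nonempty (q ↪r ρ) := by
    rw [← ofRel_le, ← φ.le_iff_le, hq', h]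
    exact hZ
  obtain ⟨α'⟩ := ofRel_le.1 ((le_iff_of_fixed hq' hAfix).2 (ofRel_le.2 ⟨inrEmb wi ρA⟩))
  have hQ : Nat.card Q = 1 + n := by
    rw [← card_eq_of_map hq', Nat.card_sum, Nat.card_fin]
  have hcone : ∀ (c : Prop × Prop) (T : Set A), T.Nonempty → (∀ a ∈ T, w i a = c) →
      Nonempty (attach (fun (_ : Fin 1) _ => c) (fun a b : T => ρA a b) ↪r q) :=
    fun c T hT hc => by
      have := hT.to_subtype
      rw [← ofRel_le, le_iff_of_fixed hq' (hφ.cone (ρ := fun a b : T => ρA a b) (fun a => hρA a) c)]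
      have e : attach (fun (_ : Fin 1) (a : T) => wi 0 a) (fun a b : T => ρA a b) ↪r
          attach wi ρA := attachEmb wi ρA (RelEmbedding.refl _) (.subtype _)
      have hwi : (fun (_ : Fin 1) (a : T) => wi 0 a) = fun _ _ => c :=
        funext fun _ => funext fun a => hc a a.2
      rw [hwi] at e
      exact ofRel_le.2 ⟨e⟩
  have hT : Nat.card ((S i : Set A)ᶜ : Set A) = n - k := by
    have h1 := Set.ncard_add_ncard_compl (S i : Set A)
    rw [Set.ncard_coe_finset, hSk, ← Nat.card_coe_set_eq] at h1
    omega
  obtain ⟨κs⟩ := hcone s (S i) (Finset.card_pos.1 (by rwa [hSk])) fun a ha => by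
    rw [hwn a, if_pos (by simpa using ha)]
  obtain ⟨κt⟩ := hcone t (S i : Set A)ᶜ (by
      have := Nat.card_pos_iff.1 (hT ▸ (by omega : 0 < n - k))
      exact Set.nonempty_coe_sort.1 this.1) fun a ha => by
    rw [hwn a, if_neg (by simpa using ha)]
  have hapex : κs (.inl 0) = κt (.inl 0) := eq_of_loops hρA α' (by omega)
    (κs.map_rel_iff.2 le_rfl) (κt.map_rel_iff.2 le_rfl)
  have h1 := card_le_of_cone (τ := fun a b : (S i : Set A) => ρA a b) (fun a => hρA a) (κs.trans δ)
  have h2 := card_le_of_cone (τ := fun a b : ((S i : Set A)ᶜ : Set A) => ρA a b) (fun a => hρA a)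
    (κt.trans δ)
  simp only [RelEmbedding.coe_trans, Function.comp_apply] at h1 h2
  rw [hT, ← hapex] at h2
  have hS' : Nat.card (S i : Set A) = k := by simpa using hSk i
  rw [hS'] at h1
  exact hcnt ⟨δ (κs (.inl 0)), δ.map_rel_iff.2 (κs.map_rel_iff.2 le_rfl)⟩ h1 h2

/-- With more than four vertices, the larger of the looped and loopless parts has at least three;
complementing loops makes it the loopless one. -/
theorem FixesSmall.apply_eq (hφ : FixesSmall φ) (x : DigraphType) : φ x = x := by
  obtain ⟨V, _, _, r, rfl⟩ := exists_ofRel x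
  by_cases hs : Nat.card V ≤ 4
  · exact hφ _ hs
  have hsum : Nat.card {v // r v v} + Nat.card {v // ¬ r v v} = Nat.card V := by
    classical
    rw [← Nat.card_sum]
    exact Nat.card_congr (Equiv.sumCompl _)
  rcases le_total (Nat.card {v // r v v}) (Nat.card {v // ¬ r v v}) with h | h
  · exact hφ.fixed_of_card_le r (by omega) h
  · refine fixed_of_swapLoops r (hφ.conj_swapLoops.fixed_of_card_le _ ?_ ?_) <;>
      simp only [swapRel_self, not_not] <;> omega

end

end DigraphType

theorem theorem3 : Finite (DigraphType ≃o DigraphType) := by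
  have := DigraphType.finite_size_le 4
  let f (φ : DigraphType ≃o DigraphType) (x : {x : DigraphType // x.size ≤ 4}) :
      {x : DigraphType // x.size ≤ 4} := ⟨φ x, by rw [DigraphType.size_map]; exact x.2⟩
  refine Finite.of_injective f fun φ ψ h => ?_
  have hfix : DigraphType.FixesSmall (φ.trans ψ.symm) := fun x hx => by
    rw [OrderIso.trans_apply, OrderIso.symm_apply_eq]
    exact Subtype.ext_iff.1 (congrFun h ⟨x, hx⟩)
  ext x
  have := hfix.apply_eq x
  rwa [OrderIso.trans_apply, OrderIso.symm_apply_eq] at this
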